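/- Let $k,l,g,h\ge 0$ be integers and let $a=\lambda_0<\lambda_1<\dots<\lambda_{g+1}=b$ and $c=\mu_0<\mu_1<\dots<\mu_{h+1}=d$ be real knots, extended by coincident boundary knots $\lambda_{-k}=\dots=\lambda_0$, $\lambda_{g+1}=\dots=\lambda_{g+k+1}$, $\mu_{-l}=\dots=\mu_0$, $\mu_{h+1}=\dots=\mu_{h+l+1}$. Put $\Omega=[a,b]\times[c,d]$. A spline of degree $k$ on $[a,b]$ with knots $(\lambda_i)$ is a function of class $C^{k-1}$ (no condition if $k=0$) that is a polynomial of degree at most $k$ on each of the intervals $[\lambda_0,\lambda_1),\dots,[\lambda_{g-1},\lambda_g),[\lambda_g,\lambda_{g+1}]$; similarly for degree $l$ on $[c,d]$ with knots $(\mu_j)$. Let $\mathcal S_{kl}(\Omega)$ be the vector space of tensor product splines, i.e. of linear combinations of products $\varphi(x)\psi(y)$ of such univariate splines, and let $\mathcal Z_{kl}(\Omega)$ be its subspace $\{s\in\mathcal S_{kl}(\Omega):\iint_\Omega s\,dx\,dy=0\}$. Let $B_i^{k+2}$ be the B-spline of degree $k+1$ with the knots $\lambda_i,\dots,\lambda_{i+k+2}$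 (Cox–de Boor recursion, with quotients with denominator $0$ read as $0$), and let $Z_i^{k+1}=\frac{d}{dx}B_i^{k+2}$, $i=-k,\dots,g-1$, be the $ZB$-splines, where the derivative is taken from the right on $[a,b)$ and from the left at $b$. Define $Z_j^{l+1}$, $j=-l,\dots,h-1$, in the same way from the knots $(\mu_j)$. Put $Z_{ij}^{k+1,l+1}(x,y)=Z_i^{k+1}(x)Z_j^{l+1}(y)$, $\overline{\mathbf Z}_{k+1}(x)=(Z_{-k}^{k+1}(x),\dots,Z_{g-1}^{k+1}(x),1)^\top$ and $\overline{\mathbf Z}_{l+1}(y)=(Z_{-l}^{l+1}(y),\dots,Z_{h-1}^{l+1}(y),1)^\top$. Then for every $s\in\mathcal Z_{kl}(\Omega)$ there are unique real coefficients $\mathbf Z=(z_{ij})$, $\mathbf v=(v_i)$, $\mathbf u=(u_j)$ ($i=-k,\dots,g-1$, $j=-l,\dots,h-1$) such that for all $(x,y)\in\Omega$ $$s(x,y)=\sum_{i=-k}^{g-1}\sum_{j=-l}^{h-1}z_{ij}Z_{ij}^{k+1,l+1}(x,y)+\sum_{i=-k}^{g-1}v_iZ_i^{k+1}(x)+\sum_{j=-l}^{h-1}u_jZ_j^{l+1}(y).$$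 Moreover, for any coefficients $\mathbf Z,\mathbf v,\mathbf u$, this representation of $s$ holds on $\Omega$ if and only if $$s(x,y)=\overline{\mathbf Z}_{k+1}(x)^\top\,\mathbf R\,\overline{\mathbf Z}_{l+1}(y)\quad\text{for all }(x,y)\in\Omega,\qquad \mathbf R=\begin{pmatrix}\mathbf Z&\mathbf v\\ \mathbf u^\top&0\end{pmatrix}.$$ -/

import Mathlib

open MeasureTheory

/-- The extended knot sequence `(λ_i)`, `i ∈ ℤ`, with coincident boundary knots: for knots
`λ_0 < ⋯ < λ_{g+1}` one puts `λ_i = λ_0` for `i < 0` and `λ_i = λ_{g+1}` for `i > g + 1`. -/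
def extKnot {g : ℕ} (lam : Fin (g + 2) → ℝ) (i : ℤ) : ℝ :=
  lam ⟨min i.toNat (g + 1), by omega⟩

/-- `bspline lam d i` is the B-spline `B_i^{d+1}` of degree `d` with knots
`λ_i, …, λ_{i+d+1}` of the extended sequence, given by the Cox–de Boor recursion; a quotient with
denominator zero is zero. B-splines of degree zero are right continuous, except that the last
nonempty knot interval also contains the right end point. -/
noncomputable def bspline {g : ℕ} (lam : Fin (g + 2) → ℝ) : ℕ → ℤ → ℝ → ℝ
  | 0, i, x =>
    open Classical in
    if (extKnot lam i ≤ x ∧ x < extKnot lam (i + 1)) ∨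
        (extKnot lam i < x ∧ x = extKnot lam (i + 1) ∧ x = lam (Fin.last (g + 1))) then 1 else 0
  | d + 1, i, x =>
    (x - extKnot lam i) / (extKnot lam (i + d + 1) - extKnot lam i) * bspline lam d i x +
    (extKnot lam (i + d + 2) - x) / (extKnot lam (i + d + 2) - extKnot lam (i + 1)) *
      bspline lam d (i + 1) x

/-- `zbspline lam k i` is the ZB-spline `Z_i^{k+1}`, the derivative of `B_i^{k+2}`. The derivative
is taken from the right, and from the left at the right end point of the interval; this only
matters at the end points and, for `k = 0`, at the knots, where the two-sided derivative need
not exist. -/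
noncomputable def zbspline {g : ℕ} (lam : Fin (g + 2) → ℝ) (k : ℕ) (i : ℤ) (x : ℝ) : ℝ :=
  open Classical in
  if x < lam (Fin.last (g + 1)) then derivWithin (bspline lam (k + 1) i) (Set.Ici x) x
  else derivWithin (bspline lam (k + 1) i) (Set.Iic x) x

/-- The knot interval `[λ_i, λ_{i+1})`, closed on the right for the last one. -/
def knotInterval {g : ℕ} (lam : Fin (g + 2) → ℝ) (i : Fin (g + 1)) : Set ℝ :=
  {x | lam i.castSucc ≤ x ∧ (x < lam i.succ ∨ (i = Fin.last g ∧ x = lam i.succ))}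

/-- `f` is, on `[λ_0, λ_{g+1}]`, a spline of degree `k` with knots `λ_0 < ⋯ < λ_{g+1}`: a
polynomial of degree at most `k` on each knot interval, and of class `C^{k-1}` on the whole interval
(no condition if `k = 0`). The values of `f` outside the interval are irrelevant. -/
def IsSpline {g : ℕ} (k : ℕ) (lam : Fin (g + 2) → ℝ) (f : ℝ → ℝ) : Prop :=
  (∀ i : Fin (g + 1), ∃ p : Polynomial ℝ, p.natDegree ≤ k ∧
    ∀ x ∈ knotInterval lam i, f x = p.eval x) ∧
  ∀ m : ℕ, m < k → ContDiffOn ℝ m f (Set.Icc (lam 0) (lam (Fin.last (g + 1))))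

/-- The rectangle `Ω = [λ_0, λ_{g+1}] × [μ_0, μ_{h+1}]`. -/
abbrev rect {g h : ℕ} (lam : Fin (g + 2) → ℝ) (mu : Fin (h + 2) → ℝ) : Set (ℝ × ℝ) :=
  Set.Icc (lam 0) (lam (Fin.last (g + 1))) ×ˢ Set.Icc (mu 0) (mu (Fin.last (h + 1)))

/-- The space `S_{kl}(Ω)` of tensor product splines: linear combinations, as functions on `Ω`, of
products `f(x) g(y)` of univariate splines of degrees `k` and `l`. -/
def tensorSplines {g h : ℕ} (k l : ℕ) (lam : Fin (g + 2) → ℝ) (mu : Fin (h + 2) → ℝ) :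
    Submodule ℝ (rect lam mu → ℝ) :=
  Submodule.span ℝ {F | ∃ φ ψ : ℝ → ℝ, IsSpline k lam φ ∧ IsSpline l mu ψ ∧
    ∀ p : rect lam mu, F p = φ p.1.1 * ψ p.1.2}

theorem IsSpline.integrableOn {g k : ℕ} {lam : Fin (g + 2) → ℝ} {f : ℝ → ℝ}
    (hf : IsSpline k lam f) :
    IntegrableOn f (Set.Icc (lam 0) (lam (Fin.last (g + 1)))) := by
  have hcover : Set.Icc (lam 0) (lam (Fin.last (g + 1))) ⊆ ⋃ i, knotInterval lam i := by
    intro x hx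
    by_contra hcon
    simp only [Set.mem_iUnion, not_exists] at hcon
    have hall : ∀ i : Fin (g + 2), lam i ≤ x := by
      intro i
      induction i using Fin.induction with
      | zero => exact hx.1
      | succ i ih =>
        by_contra hlt
        exact hcon i ⟨ih, Or.inl (not_le.mp hlt)⟩
    exact hcon (Fin.last g) ⟨hall _, Or.inr ⟨rfl, le_antisymm hx.2 (hall _)⟩⟩
  refine IntegrableOn.mono_set ?_ hcover
  rw [integrableOn_finite_iUnion]
  intro i
  obtain ⟨p, -, hp⟩ := hf.1 i
  have hmeas : MeasurableSet (knotInterval lam i) := by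
    unfold knotInterval
    measurability
  have hsub : knotInterval lam i ⊆ Set.Icc (lam i.castSucc) (lam i.succ) := by
    rintro x ⟨h1, h2 | ⟨-, h2⟩⟩
    · exact ⟨h1, h2.le⟩
    · exact ⟨h1, h2.le⟩
  have hint : IntegrableOn (fun x => p.eval x) (knotInterval lam i) :=
    (p.continuous.continuousOn.integrableOn_Icc).mono_set hsub
  exact hint.congr_fun (fun x hx => (hp x hx).symm) hmeas

theorem integrable_of_mem_tensorSplines {g h k l : ℕ} {lam : Fin (g + 2) → ℝ}
    {mu : Fin (h + 2) → ℝ} {s : rect lam mu → ℝ} (hs : s ∈ tensorSplines k l lam mu) :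
    Integrable s (Measure.comap Subtype.val volume) := by
  induction hs using Submodule.span_induction with
  | mem F hF =>
    obtain ⟨φ, ψ, hφ, hψ, hF⟩ := hF
    have h1 : IntegrableOn (fun p : ℝ × ℝ => φ p.1 * ψ p.2) (rect lam mu) := by
      have := hφ.integrableOn.mul_prod hψ.integrableOn
      rwa [Measure.prod_restrict] at this
    rw [show F = (fun p : ℝ × ℝ => φ p.1 * ψ p.2) ∘ Subtype.val from funext hF]
    exact (integrableOn_iff_comap_subtypeVal
      (measurableSet_Icc.prod measurableSet_Icc)).mp h1
  | zero => exact integrable_zero _ _ _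
  | add f g _ _ hf hg => exact hf.add hg
  | smul c f _ hf => exact hf.smul c

/-- The space `Z_{kl}(Ω)` of tensor product splines with zero integral over `Ω`,
with respect to two-dimensional Lebesgue measure restricted to `Ω`. -/
def zeroIntegralSplines {g h : ℕ} (k l : ℕ) (lam : Fin (g + 2) → ℝ) (mu : Fin (h + 2) → ℝ) :
    Submodule ℝ (rect lam mu → ℝ) where
  carrier := {s | s ∈ tensorSplines k l lam mu ∧ ∫ p, s p ∂(Measure.comap Subtype.val volume) = 0}
  add_mem' := by
    rintro s t ⟨hs, hs0⟩ ⟨ht, ht0⟩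
    refine ⟨add_mem hs ht, ?_⟩
    simp only [Pi.add_apply]
    rw [integral_add (integrable_of_mem_tensorSplines hs) (integrable_of_mem_tensorSplines ht),
      hs0, ht0, add_zero]
  zero_mem' := ⟨zero_mem _, by simp⟩
  smul_mem' := by
    rintro c s ⟨hs, hs0⟩
    refine ⟨Submodule.smul_mem _ c hs, ?_⟩
    simp only [Pi.smul_apply]
    rw [integral_smul, hs0, smul_zero]

/-- The vector `(Z_{-k}^{k+1}(x), …, Z_{g-1}^{k+1}(x))`; the entry number `i` is
`Z_{i-k}^{k+1}(x)`. -/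
noncomputable def zbVec {g : ℕ} (k : ℕ) (lam : Fin (g + 2) → ℝ) (x : ℝ) : Fin (g + k) → ℝ :=
  fun i => zbspline lam k (((i : ℕ) : ℤ) - k) x

/-- The vector `(Z_{-k}^{k+1}(x), …, Z_{g-1}^{k+1}(x), 1)`. -/
noncomputable def zbBarVec {g : ℕ} (k : ℕ) (lam : Fin (g + 2) → ℝ) (x : ℝ) :
    Fin (g + k) ⊕ Unit → ℝ :=
  Sum.elim (zbVec k lam x) (fun _ => 1)

/-- The matrix `R` with blocks `Z`, `v`, `uᵀ`, `0`. -/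
def coeffMatrix {m n : ℕ} (z : Matrix (Fin m) (Fin n) ℝ) (v : Fin m → ℝ) (u : Fin n → ℝ) :
    Matrix (Fin m ⊕ Unit) (Fin n ⊕ Unit) ℝ :=
  Matrix.fromBlocks z (Matrix.replicateCol Unit v) (Matrix.replicateRow Unit u) 0

/-- The function on `Ω` given by
`∑ z_ij Z_i^{k+1}(x) Z_j^{l+1}(y) + ∑ v_i Z_i^{k+1}(x) + ∑ u_j Z_j^{l+1}(y)`. -/
noncomputable def zbCombination {g h : ℕ} (k l : ℕ) (lam : Fin (g + 2) → ℝ)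
    (mu : Fin (h + 2) → ℝ) (z : Matrix (Fin (g + k)) (Fin (h + l)) ℝ) (v : Fin (g + k) → ℝ)
    (u : Fin (h + l) → ℝ) : rect lam mu → ℝ :=
  fun p => ∑ i, ∑ j, z i j * (zbVec k lam p.1.1 i * zbVec l mu p.1.2 j) +
    ∑ i, v i * zbVec k lam p.1.1 i + ∑ j, u j * zbVec l mu p.1.2 j

/-! In one variable, the ZB-splines together with the constant 1 form a basis of the splines.
Differentiating `∑ e_j B_j` in degree `k + 1` gives the combination of B-splines of degree `k` with
coefficients `(k + 1) (e_{j+1} - e_j) / Δ_j`, where `Δ_j > 0` is the length of the support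
(`derivative_sum_bpoly`). Combinations of ZB-splines correspond to the sequences `e` that vanish at
both ends, so they fill exactly the hyperplane `∑ c_j Δ_j = 0` of coefficient vectors. The constant
1 has all coefficients equal to one (`sum_bpoly`) and lies off it. That the B-splines themselves are
a basis follows from the same formula by induction on the degree (`bpoly_linearIndependent`,
`exists_eq_sum_bpoly`).

A ZB-spline has integral zero, since the B-spline it comes from is continuous and vanishes at both
ends (`zbspline_integral`).

Hence a tensor spline is `Z̄ᵀ R Z̄` for a unique matrix `R`, and by Fubini its integral is the
corner entry of `R` times the area of the rectangle. The integral is zero exactly when the corner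
entry is. -/

open Polynomial in
/-- The polynomial that coincides with the B-spline of degree `d` and index `i` for the knots `t`
on the knot interval `[t m, t (m + 1))`. -/
noncomputable def bpoly (t : ℤ → ℝ) (m : ℤ) : ℕ → ℤ → ℝ[X]
  | 0, i => if i = m then 1 else 0
  | d + 1, i =>
    C (t (i + d + 1) - t i)⁻¹ * (X - C (t i)) * bpoly t m d i +
    C (t (i + d + 2) - t (i + 1))⁻¹ * (C (t (i + d + 2)) - X) * bpoly t m d (i + 1)

/-! ### B-splines as families of polynomials, one per knot interval -/

section BPoly

open Polynomial

variable {t : ℤ → ℝ} {m : ℤ}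

theorem bpoly_eq_zero (d : ℕ) (i : ℤ) (h : m < i ∨ i + d < m) : bpoly t m d i = 0 := by
  induction d generalizing i with
  | zero =>
    rw [bpoly, if_neg]
    rintro rfl
    simp at h
  | succ d ih =>
    push_cast at h
    rw [bpoly, ih i (by omega), ih (i + 1) (by omega)]
    simp

theorem bpoly_derivative (ht : Monotone t) (d : ℕ) (i : ℤ) :
    derivative (bpoly t m (d + 1) i) =
      C ((d : ℝ) + 1) * (C (t (i + d + 1) - t i)⁻¹ * bpoly t m d i -
        C (t (i + d + 2) - t (i + 1))⁻¹ * bpoly t m d (i + 1)) := by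
  induction d generalizing i with
  | zero =>
    rw [bpoly.eq_2]
    have h0 : ∀ j, derivative (bpoly t m 0 j) = 0 := by
      intro j
      rw [bpoly]
      split_ifs <;> simp
    simp only [derivative_add, derivative_mul, derivative_C, derivative_sub, derivative_X, h0]
    simp only [Nat.cast_zero, zero_add, C_1]
    ring
  | succ d ih =>
    rw [bpoly]
    simp only [derivative_add, derivative_mul, derivative_C, derivative_sub, derivative_X, ih]
    rw [show bpoly t m (d + 1) i = _ from by rw [bpoly],
      show bpoly t m (d + 1) (i + 1) = _ from by rw [bpoly]]
    have e1 : i + 1 + (d : ℤ) + 1 = i + d + 2 := by ring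
    have e2 : i + 1 + (d : ℤ) + 2 = i + d + 3 := by ring
    have e3 : i + ((d + 1 : ℕ) : ℤ) + 1 = i + d + 2 := by push_cast; ring
    have e4 : i + ((d + 1 : ℕ) : ℤ) + 2 = i + d + 3 := by push_cast; ring
    have e5 : i + 1 + 1 = i + 2 := by ring
    simp only [e1, e2, e3, e4, e5]
    -- This makes the cross terms in `bpoly t m d (i + 1)` cancel. Either the common prefactor is
    -- `0⁻¹ = 0`, or both longer knot spans are positive and both quotients are one.
    have key : (t (i + d + 2) - t (i + 1))⁻¹ * ((t (i + d + 2) - t i)⁻¹ * (t (i + d + 2) - t i)) =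
        (t (i + d + 2) - t (i + 1))⁻¹ * ((t (i + d + 3) - t (i + 1))⁻¹ *
          (t (i + d + 3) - t (i + 1))) := by
      rcases eq_or_ne (t (i + d + 2)) (t (i + 1)) with h | h
      · simp [h]
      · have h1 : t (i + 1) < t (i + d + 2) := lt_of_le_of_ne (ht (by omega)) (Ne.symm h)
        have h2 : t i ≤ t (i + 1) := ht (by omega)
        have h3 : t (i + d + 2) ≤ t (i + d + 3) := ht (by omega)
        rw [inv_mul_cancel₀ (by linarith), inv_mul_cancel₀ (by linarith)]
    have keyC := congrArg (C : ℝ → ℝ[X]) key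
    simp only [C_mul, C_sub] at keyC
    simp only [C_add, C_1, Nat.cast_succ]
    linear_combination (-(C (d : ℝ) + 1) * bpoly t m d (i + 1)) * keyC

/-- Each B-spline of degree `d` enters two neighbours of degree `d + 1`, with weights that add up to
one, so raising the degree does not change the sum. The two leftover terms at the ends vanish on the
interval. -/
theorem sum_bpoly (ht : Monotone t) (hm : t m < t (m + 1)) {g : ℕ} (h0 : 0 ≤ m) (hg : m ≤ g)
    (d : ℕ) : ∑ j ∈ Finset.range (g + d + 1), bpoly t m d ((j : ℤ) - d) = 1 := by
  induction d with
  | zero =>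
    lift m to ℕ using h0
    simp only [bpoly]
    rw [Finset.sum_eq_single m]
    · simp
    · intro b _ hb
      rw [if_neg (by simpa using hb)]
    · intro hb
      simp at hb
      omega
  | succ d ih =>
    set A : ℕ → ℝ[X] := fun j => C (t (j) - t (j - d - 1))⁻¹ * (X - C (t (j - d - 1))) *
      bpoly t m d (j - d - 1) with hA
    set B : ℕ → ℝ[X] := fun j => C (t (j) - t (j - d - 1))⁻¹ * (C (t (j)) - X) *
      bpoly t m d (j - d - 1) with hB
    have hAB : ∀ j : ℕ, bpoly t m (d + 1) ((j : ℤ) - (d + 1 : ℕ)) = A j + B (j + 1) := by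
      intro j
      rw [bpoly, hA, hB]
      have e1 : (j : ℤ) - (d + 1 : ℕ) + d + 1 = j := by push_cast; ring
      have e2 : (j : ℤ) - (d + 1 : ℕ) + d + 2 = (j + 1 : ℕ) := by push_cast; ring
      have e3 : (j : ℤ) - (d + 1 : ℕ) + 1 = (j + 1 : ℕ) - d - 1 := by push_cast; ring
      have e4 : (j : ℤ) - (d + 1 : ℕ) = j - d - 1 := by push_cast; ring
      rw [e1, e2, e3, e4]
    have hA0 : A 0 = 0 := by
      simp only [hA]
      rw [bpoly_eq_zero d _ (by right; push_cast; omega), mul_zero]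
    have hBn : B (g + d + 1 + 1) = 0 := by
      simp only [hB]
      rw [bpoly_eq_zero d _ (by left; push_cast; omega), mul_zero]
    have hsum : ∀ j : ℕ, A (j + 1) + B (j + 1) = bpoly t m d ((j : ℤ) - d) := by
      intro j
      simp only [hA, hB]
      have e4 : ((j + 1 : ℕ) : ℤ) - d - 1 = j - d := by push_cast; ring
      rw [e4]
      -- A zero denominator is harmless: where the B-spline is not zero, its support contains `[t m,
      -- t (m + 1)]`.
      by_cases hs : m < (j : ℤ) - d ∨ (j : ℤ) - d + d < m
      · rw [bpoly_eq_zero d _ hs]; simp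
      · have h1 : t (j - d) ≤ t m := ht (by omega)
        have h2 : t (m + 1) ≤ t (j + 1 : ℕ) := ht (by push_cast; omega)
        have h3 : (t (j + 1 : ℕ) - t (j - d))⁻¹ * (t (j + 1 : ℕ) - t (j - d)) = 1 :=
          inv_mul_cancel₀ (by linarith)
        have h4 := congrArg (C : ℝ → ℝ[X]) h3
        simp only [C_mul, C_sub, C_1] at h4
        linear_combination (bpoly t m d (j - d)) * h4
    rw [show g + (d + 1) + 1 = g + d + 1 + 1 from by ring, Finset.sum_congr rfl (fun j _ => hAB j),
      Finset.sum_add_distrib, Finset.sum_range_succ' A, hA0,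
      Finset.sum_range_succ (fun j => B (j + 1)), hBn, add_zero, add_zero,
      ← Finset.sum_add_distrib, Finset.sum_congr rfl (fun j _ => hsum j), ih]

/-- Continuity at a simple knot. Degree zero jumps, so the induction starts from the hat functions;
after that the recursion has the same weights on both sides. -/
theorem bpoly_eval_knot (h1 : t m < t (m + 1)) (h2 : t (m + 1) < t (m + 2)) (d : ℕ) (i : ℤ) :
    (bpoly t m (d + 1) i).eval (t (m + 1)) = (bpoly t (m + 1) (d + 1) i).eval (t (m + 1)) := by
  induction d generalizing i with
  | zero =>
    have e : i + ((0 : ℕ) : ℤ) + 1 = i + 1 := by simp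
    have e' : i + ((0 : ℕ) : ℤ) + 2 = i + 2 := by simp
    simp only [bpoly, e, e']
    rcases eq_or_ne i m with rfl | hi
    · have a1 : t (i + 1) - t i ≠ 0 := by linarith
      have a2 : t (i + 2) - t (i + 1) ≠ 0 := by linarith
      simp [a1, a2]
    · rcases eq_or_ne i (m + 1) with rfl | hi'
      · simp [show m + 1 + 1 ≠ m by omega]
      · rcases eq_or_ne (i + 1) m with rfl | hi''
        · simp [show i + 1 + 1 = i + 2 by ring]
        · simp [hi, hi', hi'']
  | succ d ih =>
    rw [bpoly, bpoly.eq_2 t (m + 1)]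
    simp only [eval_add, eval_mul, ih]

theorem bpoly_eval_left (h0 : ∀ i ≤ 0, t i = t 0) (d : ℕ) (i : ℤ) (hi : -(d : ℤ) < i) :
    (bpoly t 0 d i).eval (t 0) = 0 := by
  induction d generalizing i with
  | zero =>
    rw [bpoly, if_neg (by simp at hi; omega), eval_zero]
  | succ d ih =>
    push_cast at hi
    rw [bpoly]
    simp only [eval_add, eval_mul, ih (i + 1) (by omega), mul_zero, add_zero]
    -- The induction hypothesis misses only `i = -d`, where the factor `X - t i` vanishes at `t 0`.
    by_cases h : -(d : ℤ) < i
    · rw [ih i h, mul_zero]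
    · rw [h0 i (by omega)]; simp

theorem bpoly_eval_right (h0 : ∀ i, m + 1 ≤ i → t i = t (m + 1)) (d : ℕ) (i : ℤ) (hi : i < m) :
    (bpoly t m d i).eval (t (m + 1)) = 0 := by
  induction d generalizing i with
  | zero =>
    rw [bpoly, if_neg (by omega), eval_zero]
  | succ d ih =>
    rw [bpoly]
    simp only [eval_add, eval_mul, ih i hi, mul_zero, zero_add]
    by_cases h : i + 1 < m
    · rw [ih _ h, mul_zero]
    · rw [h0 (i + d + 2) (by omega)]; simp

theorem sum_range_mul_sub_succ {R : Type*} [CommRing R] (e f : ℕ → R) (n : ℕ) :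
    ∑ j ∈ Finset.range (n + 1), e j * (f j - f (j + 1)) =
      e 0 * f 0 - e n * f (n + 1) + ∑ j ∈ Finset.range n, (e (j + 1) - e j) * f (j + 1) := by
  induction n with
  | zero => simp; ring
  | succ n ih => rw [Finset.sum_range_succ, ih, Finset.sum_range_succ _ n]; ring

/-- Summation by parts. The boundary terms carry the indices `-d - 1` and `g + 1`, whose supports
miss the interval. -/
theorem derivative_sum_bpoly (ht : Monotone t) {g : ℕ} (h0 : 0 ≤ m) (hg : m ≤ g)
    (d : ℕ) (e : ℕ → ℝ) :
    derivative (∑ j ∈ Finset.range (g + (d + 1) + 1),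
        C (e j) * bpoly t m (d + 1) ((j : ℤ) - (d + 1 : ℕ))) =
      ∑ j ∈ Finset.range (g + d + 1),
        C (((d : ℝ) + 1) * (t (j + 1) - t (j - d))⁻¹ * (e (j + 1) - e j)) *
          bpoly t m d ((j : ℤ) - d) := by
  set f : ℕ → ℝ[X] := fun j => C ((d : ℝ) + 1) * (C (t j - t (j - d - 1))⁻¹ *
    bpoly t m d (j - d - 1)) with hf
  have hd : ∀ j : ℕ, derivative (C (e j) * bpoly t m (d + 1) ((j : ℤ) - (d + 1 : ℕ))) =
      C (e j) * (f j - f (j + 1)) := by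
    intro j
    rw [derivative_C_mul, bpoly_derivative ht]
    simp only [hf]
    have e1 : (j : ℤ) - (d + 1 : ℕ) + d + 1 = j := by push_cast; ring
    have e2 : (j : ℤ) - (d + 1 : ℕ) + d + 2 = (j + 1 : ℕ) := by push_cast; ring
    have e3 : (j : ℤ) - (d + 1 : ℕ) + 1 = (j + 1 : ℕ) - d - 1 := by push_cast; ring
    have e4 : (j : ℤ) - (d + 1 : ℕ) = j - d - 1 := by push_cast; ring
    rw [e1, e2, e3, e4, mul_sub]
  have hf0 : f 0 = 0 := by
    simp only [hf]
    rw [bpoly_eq_zero d _ (by right; push_cast; omega), mul_zero, mul_zero]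
  have hfn : f (g + d + 1 + 1) = 0 := by
    simp only [hf]
    rw [bpoly_eq_zero d _ (by left; push_cast; omega), mul_zero, mul_zero]
  rw [derivative_sum, Finset.sum_congr rfl (fun j _ => hd j),
    show g + (d + 1) + 1 = g + d + 1 + 1 from by ring, sum_range_mul_sub_succ (fun j => C (e j)),
    hf0, hfn, mul_zero, mul_zero, sub_zero, zero_add]
  refine Finset.sum_congr rfl fun j _ => ?_
  simp only [hf]
  have e4 : ((j + 1 : ℕ) : ℤ) - d - 1 = j - d := by push_cast; ring
  rw [e4]
  push_cast
  simp only [C_mul, C_sub]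
  ring

/-- The knots `t 0 < ⋯ < t (g + 1)` are distinct, and all other knots coincide with a boundary
knot. -/
structure IsKnotSeq (g : ℕ) (t : ℤ → ℝ) : Prop where
  mono : Monotone t
  lt_succ : ∀ m : ℕ, m ≤ g → t m < t (m + 1)
  left : ∀ i ≤ 0, t i = t 0
  right : ∀ i, (g : ℤ) + 1 ≤ i → t i = t (g + 1)

/-! ### Linear independence and spanning for B-splines -/

theorem IsKnotSeq.lt {g : ℕ} (ht : IsKnotSeq g t) {d j : ℕ} (hj : j < g + d + 1) :
    t (j - d) < t (j + 1) := by
  by_cases hjg : j ≤ g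
  · exact (ht.mono (by omega)).trans_lt (ht.lt_succ j hjg)
  · exact (ht.mono (by omega)).trans_lt ((ht.lt_succ g le_rfl).trans_le (ht.mono (by omega)))

/-- Differentiation and the induction hypothesis make all coefficients equal; partition of unity
then makes them zero. -/
theorem bpoly_linearIndependent {g : ℕ} (ht : IsKnotSeq g t) (d : ℕ) (c : ℕ → ℝ)
    (hc : ∀ m : ℕ, m ≤ g →
      ∑ j ∈ Finset.range (g + d + 1), C (c j) * bpoly t m d ((j : ℤ) - d) = 0) :
    ∀ j < g + d + 1, c j = 0 := by
  induction d generalizing c with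
  | zero =>
    intro j hj
    have := hc j (by omega)
    rw [Finset.sum_eq_single j] at this
    · simpa [bpoly] using this
    · intro b _ hb
      rw [bpoly, if_neg (by simpa using hb), mul_zero]
    · intro hb
      exact absurd (Finset.mem_range.mpr hj) hb
  | succ d ih =>
    have h1 : ∀ j < g + d + 1, c (j + 1) = c j := by
      intro j hj
      have := ih (fun j => ((d : ℝ) + 1) * (t (j + 1) - t (j - d))⁻¹ * (c (j + 1) - c j))
        (fun m hm => by
          rw [← derivative_sum_bpoly ht.mono (by positivity) (by exact_mod_cast hm), hc m hm,
            derivative_zero]) j hj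
      have hpos := ht.lt hj
      have hd : (d : ℝ) + 1 ≠ 0 := by positivity
      have := (mul_eq_zero.mp this).resolve_left
        (mul_ne_zero hd (inv_ne_zero (by linarith)))
      linarith
    have h2 : ∀ j < g + (d + 1) + 1, c j = c 0 := by
      intro j
      induction j with
      | zero => intro _; rfl
      | succ j ihj => intro hj; rw [h1 j (by omega), ihj (by omega)]
    have h3 := hc 0 (by omega)
    rw [Nat.cast_zero, Finset.sum_congr rfl (fun j hj => by rw [h2 j (Finset.mem_range.mp hj)]),
      ← Finset.mul_sum, sum_bpoly ht.mono (by simpa using ht.lt_succ 0 (by omega)) le_rfl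
        (by positivity), mul_one, C_eq_zero] at h3
    intro j hj
    rw [h2 j hj, h3]

/-- The derivatives satisfy one matching condition fewer and are covered by induction. Integrating
their expansion leaves an error that is constant on each piece; continuity at the knots makes it a
single constant, absorbed by partition of unity. -/
theorem exists_eq_sum_bpoly {g : ℕ} (ht : IsKnotSeq g t) (k : ℕ) (p : ℕ → ℝ[X])
    (hdeg : ∀ m ≤ g, (p m).natDegree ≤ k)
    (hp : ∀ m < g, ∀ r < k, (derivative^[r] (p m)).eval (t (m + 1)) =
      (derivative^[r] (p (m + 1))).eval (t (m + 1))) :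
    ∃ c : ℕ → ℝ, ∀ m : ℕ, m ≤ g →
      p m = ∑ j ∈ Finset.range (g + k + 1), C (c j) * bpoly t m k ((j : ℤ) - k) := by
  induction k generalizing p with
  | zero =>
    refine ⟨fun j => (p j).coeff 0, fun m hm => ?_⟩
    rw [Finset.sum_eq_single m]
    · have := eq_C_of_natDegree_le_zero (hdeg m hm)
      simpa [bpoly] using this
    · intro b _ hb
      rw [bpoly, if_neg (by simpa using hb), mul_zero]
    · intro hb
      exact absurd (Finset.mem_range.mpr (by omega)) hb
  | succ k ih =>
    obtain ⟨c, hc⟩ := ih (fun m => derivative (p m))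
      (fun m hm => (natDegree_derivative_le _).trans (by have := hdeg m hm; omega))
      (fun m hm r hr => by
        have := hp m hm (r + 1) (by omega)
        simpa only [Function.iterate_succ, Function.comp] using this)
    -- Solves `(k + 1) (e (j + 1) - e j) / (t (j + 1) - t (j - k)) = c j`.
    set e : ℕ → ℝ := fun n => ∑ j ∈ Finset.range n, c j * (t (j + 1) - t (j - k)) / (k + 1) with he
    set F : ℕ → ℝ[X] := fun m => ∑ j ∈ Finset.range (g + (k + 1) + 1),
      C (e j) * bpoly t m (k + 1) ((j : ℤ) - (k + 1 : ℕ)) with hF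
    have hder : ∀ m : ℕ, m ≤ g → derivative (p m - F m) = 0 := by
      intro m hm
      rw [derivative_sub, hF, derivative_sum_bpoly ht.mono (by positivity) (by exact_mod_cast hm),
        hc m hm, sub_eq_zero]
      refine Finset.sum_congr rfl fun j hj => ?_
      have hpos := ht.lt (Finset.mem_range.mp hj)
      have hne : t (j + 1) - t (j - k) ≠ 0 := by linarith
      have hk : (k : ℝ) + 1 ≠ 0 := by positivity
      congr 2
      simp only [he, Finset.sum_range_succ]
      field_simp
      ring
    have hconst : ∀ m : ℕ, m ≤ g → p m - F m = C ((p m - F m).coeff 0) := fun m hm =>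
      eq_C_of_derivative_eq_zero (hder m hm)
    have hstep : ∀ m : ℕ, m < g → (p (m + 1) - F (m + 1)).coeff 0 = (p m - F m).coeff 0 := by
      intro m hm
      have h1 := congrArg (eval (t (m + 1))) (hconst m hm.le)
      have h2 := congrArg (eval (t (m + 1))) (hconst (m + 1) hm)
      rw [eval_C] at h1 h2
      rw [← h1, ← h2, eval_sub, eval_sub]
      have h3 := hp m hm 0 (by omega)
      simp only [Function.iterate_zero, id] at h3
      rw [h3]
      congr 1
      simp only [hF, eval_finsetSum, eval_mul]
      refine Finset.sum_congr rfl fun j _ => ?_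
      have h4 := ht.lt_succ (m + 1) hm
      push_cast at h4 ⊢
      rw [bpoly_eval_knot (ht.lt_succ m hm.le) (by rwa [add_assoc] at h4)]
    have hall : ∀ m : ℕ, m ≤ g → (p m - F m).coeff 0 = (p 0 - F 0).coeff 0 := by
      intro m
      induction m with
      | zero => intro _; rfl
      | succ m ihm => intro hm; rw [hstep m hm, ihm (by omega)]
    refine ⟨fun j => e j + (p 0 - F 0).coeff 0, fun m hm => ?_⟩
    simp only [C_add, add_mul, Finset.sum_add_distrib]
    rw [← Finset.mul_sum, sum_bpoly ht.mono (ht.lt_succ m hm) (by positivity)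
      (by exact_mod_cast hm), mul_one, ← hall m hm, ← hconst m hm]
    simp only [hF]
    ring

end BPoly

/-! ### From polynomial pieces to splines on the interval -/

section ExtKnot

variable {g : ℕ} {lam : Fin (g + 2) → ℝ}

theorem extKnot_val (i : Fin (g + 2)) : extKnot lam ((i : ℕ) : ℤ) = lam i := by
  unfold extKnot
  congr 1
  ext
  simp
  omega

theorem extKnot_val_castSucc (i : Fin (g + 1)) :
    extKnot lam ((i : ℕ) : ℤ) = lam i.castSucc := by
  rw [← extKnot_val (lam := lam), Fin.val_castSucc]

theorem extKnot_val_succ (i : Fin (g + 1)) :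
    extKnot lam (((i : ℕ) : ℤ) + 1) = lam i.succ := by
  rw [← extKnot_val (lam := lam), Fin.val_succ, Nat.cast_succ]

theorem extKnot_zero : extKnot lam 0 = lam 0 := by
  rw [← extKnot_val (lam := lam), Fin.val_zero, Nat.cast_zero]

theorem extKnot_last : extKnot lam ((g : ℤ) + 1) = lam (Fin.last (g + 1)) := by
  rw [← extKnot_val (lam := lam), Fin.val_last, Nat.cast_succ]

theorem isKnotSeq_extKnot (hlam : StrictMono lam) : IsKnotSeq g (extKnot lam) where
  mono i j hij := hlam.monotone (by rw [Fin.mk_le_mk]; omega)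
  lt_succ m hm := hlam (by rw [Fin.mk_lt_mk]; omega)
  left i hi := by
    unfold extKnot
    congr 2
    omega
  right i hi := by
    unfold extKnot
    congr 2
    omega

theorem exists_mem_knotInterval {x : ℝ} (hx : x ∈ Set.Icc (lam 0) (lam (Fin.last (g + 1)))) :
    ∃ i, x ∈ knotInterval lam i := by
  by_contra hcon
  push Not at hcon
  have hall : ∀ i : Fin (g + 2), lam i ≤ x := by
    intro i
    induction i using Fin.induction with
    | zero => exact hx.1
    | succ i ih =>
      by_contra hlt
      exact hcon i ⟨ih, Or.inl (not_le.mp hlt)⟩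
  exact hcon (Fin.last g) ⟨hall _, Or.inr ⟨rfl, le_antisymm hx.2 (hall _)⟩⟩

theorem Ioo_subset_knotInterval (i : Fin (g + 1)) :
    Set.Ioo (lam i.castSucc) (lam i.succ) ⊆ knotInterval lam i :=
  fun _ hx => ⟨hx.1.le, Or.inl hx.2⟩

theorem knotInterval_subset_Icc (hlam : Monotone lam) (i : Fin (g + 1)) :
    knotInterval lam i ⊆ Set.Icc (lam 0) (lam (Fin.last (g + 1))) := by
  rintro x ⟨h1, h2⟩
  refine ⟨(hlam (Fin.zero_le _)).trans h1, ?_⟩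
  have h3 : lam i.succ ≤ lam (Fin.last (g + 1)) := hlam (Fin.le_last _)
  rcases h2 with h2 | ⟨-, h2⟩ <;> linarith

theorem Polynomial.eq_of_eval_eq_on_knotInterval (hlam : StrictMono lam) (i : Fin (g + 1))
    {p q : Polynomial ℝ} (h : ∀ x ∈ knotInterval lam i, p.eval x = q.eval x) : p = q :=
  Polynomial.eq_of_infinite_eval_eq p q <|
    ((Set.Ioo_infinite (hlam i.castSucc_lt_succ)).mono (Ioo_subset_knotInterval i)).mono h

theorem bspline_eq_eval_bpoly (hlam : StrictMono lam) {m : Fin (g + 1)} {x : ℝ}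
    (hx : x ∈ knotInterval lam m) (d : ℕ) (i : ℤ) :
    bspline lam d i x = (bpoly (extKnot lam) (m : ℕ) d i).eval x := by
  have ht := isKnotSeq_extKnot hlam
  induction d generalizing i with
  | zero =>
    obtain ⟨h1, h2⟩ := hx
    rw [← extKnot_val_castSucc (lam := lam)] at h1
    rw [← extKnot_val_succ (lam := lam)] at h2
    have hmg : extKnot lam ((m : ℕ) + 1) ≤ extKnot lam (g + 1) := ht.mono (by omega)
    suffices h : ((extKnot lam i ≤ x ∧ x < extKnot lam (i + 1)) ∨
        (extKnot lam i < x ∧ x = extKnot lam (i + 1) ∧ x = lam (Fin.last (g + 1)))) ↔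
        i = (m : ℕ) by
      rw [bspline, bpoly]
      simp only [h]
      split_ifs <;> simp
    rw [← extKnot_last (lam := lam)]
    constructor
    · rintro (⟨h3, h4⟩ | ⟨h3, h4, h5⟩)
      · have h6 : ((m : ℕ) : ℤ) < i + 1 := ht.mono.reflect_lt (h1.trans_lt h4)
        rcases h2 with h2 | ⟨rfl, h2⟩
        · have h7 : i < (m : ℕ) + 1 := ht.mono.reflect_lt (h3.trans_lt h2)
          omega
        · rw [Fin.val_last] at h2
          have h7 : extKnot lam (i + 1) ≤ extKnot lam (g + 1) := by
            rcases le_total (i + 1) (g + 1) with h | h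
            · exact ht.mono h
            · exact (ht.right _ h).le
          linarith
      -- At the right end point the strict inequality on the left knot discards the empty intervals
      -- of coincident knots, so only `i = g` survives.
      · rcases h2 with h2 | ⟨rfl, h2⟩
        · linarith
        · rw [Fin.val_last]
          have h6 : i < g + 1 := ht.mono.reflect_lt (h5 ▸ h3)
          have h7 : (g : ℤ) < i + 1 :=
            ht.mono.reflect_lt ((ht.lt_succ g le_rfl).trans_eq (h5.symm.trans h4))
          omega
    · rintro rfl
      rcases h2 with h2 | ⟨rfl, h2⟩
      · exact Or.inl ⟨h1, h2⟩
      · rw [Fin.val_last] at h2 ⊢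
        exact Or.inr ⟨by rw [h2]; exact ht.lt_succ g le_rfl, h2, h2⟩
  | succ d ih =>
    rw [bspline, bpoly, ih, ih]
    simp only [Polynomial.eval_add, Polynomial.eval_mul, Polynomial.eval_sub, Polynomial.eval_C,
      Polynomial.eval_X]
    ring

/-- The chosen side keeps a one-sided neighbourhood of `x` inside the knot interval, so the
derivative sees a single polynomial. -/
theorem zbspline_eq_eval_derivative (hlam : StrictMono lam) {m : Fin (g + 1)} {x : ℝ}
    (hx : x ∈ knotInterval lam m) (k : ℕ) (i : ℤ) :
    zbspline lam k i x =
      (Polynomial.derivative (bpoly (extKnot lam) (m : ℕ) (k + 1) i)).eval x := by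
  have hx' := hx
  obtain ⟨h1, h2⟩ := hx
  have h3 : lam m.succ ≤ lam (Fin.last (g + 1)) := hlam.monotone (Fin.le_last _)
  have hp := (bpoly (extKnot lam) (m : ℕ) (k + 1) i).hasDerivAt x
  unfold zbspline
  rcases h2 with h2 | ⟨rfl, h2⟩
  · rw [if_pos (h2.trans_le h3)]
    refine (hp.hasDerivWithinAt.congr_of_eventuallyEq_of_mem ?_ Set.self_mem_Ici).derivWithin
      (uniqueDiffWithinAt_Ici x)
    filter_upwards [Ico_mem_nhdsGE h2] with y hy
    exact bspline_eq_eval_bpoly hlam (m := m) ⟨h1.trans hy.1, Or.inl hy.2⟩ _ _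
  · rw [if_neg (by rw [h2, Fin.succ_last]; exact lt_irrefl _)]
    refine (hp.hasDerivWithinAt.congr_of_eventuallyEq_of_mem ?_ Set.self_mem_Iic).derivWithin
      (uniqueDiffWithinAt_Iic x)
    have h4 : lam (Fin.last g).castSucc < x := h2 ▸ hlam (Fin.last g).castSucc_lt_succ
    filter_upwards [Ioc_mem_nhdsLE h4] with y hy
    refine bspline_eq_eval_bpoly hlam (m := Fin.last g) ⟨hy.1.le, ?_⟩ _ _
    rcases hy.2.lt_or_eq with h | h
    · exact Or.inl (h.trans_eq h2)
    · exact Or.inr ⟨rfl, h.trans h2⟩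

theorem iteratedDerivWithin_eq_eval_of_mem_Ioo {f : ℝ → ℝ} {s : Set ℝ} {p : Polynomial ℝ}
    {u v : ℝ} (hs : Set.Ioo u v ⊆ s) (hf : ∀ x ∈ Set.Ioo u v, f x = p.eval x) (r : ℕ) :
    ∀ x ∈ Set.Ioo u v, iteratedDerivWithin r f s x = (Polynomial.derivative^[r] p).eval x := by
  induction r with
  | zero => simpa using hf
  | succ r ih =>
    intro x hx
    have hnhds : Set.Ioo u v ∈ nhds x := isOpen_Ioo.mem_nhds hx
    rw [iteratedDerivWithin_succ, derivWithin_of_mem_nhds (Filter.mem_of_superset hnhds hs),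
      Function.iterate_succ_apply', ← Polynomial.deriv]
    exact Filter.EventuallyEq.deriv_eq (Filter.eventually_of_mem hnhds ih)

theorem IsSpline.exists_eq_sum_bpoly (hlam : StrictMono lam) {k : ℕ} {f : ℝ → ℝ}
    (hf : IsSpline k lam f) :
    ∃ c : ℕ → ℝ, ∀ m : Fin (g + 1), ∀ x ∈ knotInterval lam m,
      f x = (∑ j ∈ Finset.range (g + k + 1),
        Polynomial.C (c j) * bpoly (extKnot lam) (m : ℕ) k ((j : ℤ) - k)).eval x := by
  have ht := isKnotSeq_extKnot hlam
  obtain ⟨hpoly, hsmooth⟩ := hf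
  choose p hdeg hp using hpoly
  -- The equality holds on the open interval and extends to its closure by continuity. At an
  -- interior knot both neighbouring polynomials thus share their derivatives of order below `k`.
  have hclosed : ∀ r < k, ∀ m : Fin (g + 1), ∀ x ∈ Set.Icc (lam m.castSucc) (lam m.succ),
      iteratedDerivWithin r f (Set.Icc (lam 0) (lam (Fin.last (g + 1)))) x =
        (Polynomial.derivative^[r] (p m)).eval x := by
    intro r hr m
    have hlt := hlam m.castSucc_lt_succ
    have hsub : Set.Icc (lam m.castSucc) (lam m.succ) ⊆
        Set.Icc (lam 0) (lam (Fin.last (g + 1))) :=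
      Set.Icc_subset_Icc (hlam.monotone (Fin.zero_le _)) (hlam.monotone (Fin.le_last _))
    have hEq := iteratedDerivWithin_eq_eval_of_mem_Ioo (Set.Ioo_subset_Icc_self.trans hsub)
      (fun x hx => hp m x (Ioo_subset_knotInterval m hx)) r
    have hcont := (hsmooth r hr).continuousOn_iteratedDerivWithin le_rfl
      (uniqueDiffOn_Icc (hlam (Fin.last_pos)))
    exact Set.EqOn.of_subset_closure hEq (hcont.mono hsub) (Polynomial.continuous _).continuousOn
      Set.Ioo_subset_Icc_self (closure_Ioo hlt.ne).ge
  obtain ⟨c, hc⟩ := _root_.exists_eq_sum_bpoly ht k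
    (fun m => if h : m < g + 1 then p ⟨m, h⟩ else 0)
    (fun m hm => by rw [dif_pos (Nat.lt_succ_of_le hm)]; exact hdeg _)
    (fun m hm r hr => by
      have hm1 : m < g + 1 := by omega
      have hm2 : m + 1 < g + 1 := by omega
      rw [dif_pos hm1, dif_pos hm2]
      have e1 : extKnot lam ((m : ℤ) + 1) = lam (Fin.succ ⟨m, hm1⟩) :=
        extKnot_val_succ ⟨m, hm1⟩
      have e2 : lam (Fin.succ ⟨m, hm1⟩) = lam (Fin.castSucc ⟨m + 1, hm2⟩) := rfl
      rw [e1, ← hclosed r hr ⟨m, hm1⟩ _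
        (Set.right_mem_Icc.mpr (hlam.monotone (Fin.castSucc_lt_succ).le)), e2,
        hclosed r hr ⟨m + 1, hm2⟩ _
        (Set.left_mem_Icc.mpr (hlam.monotone (Fin.castSucc_lt_succ).le))])
  refine ⟨c, fun m x hx => ?_⟩
  have h := hc m (by omega)
  rw [dif_pos m.2] at h
  rw [hp m x hx, ← h]

/-! ### ZB-splines and the constant 1 as a basis; zero integrals -/

theorem sum_zbVec_eq_eval (hlam : StrictMono lam) (k : ℕ) {m : Fin (g + 1)} {x : ℝ}
    (hx : x ∈ knotInterval lam m) (e : ℕ → ℝ) (h0 : e 0 = 0) (hn : e (g + k + 1) = 0) :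
    ∑ i : Fin (g + k), e (i + 1) * zbVec k lam x i =
      (∑ j ∈ Finset.range (g + k + 1),
        Polynomial.C (((k : ℝ) + 1) * (extKnot lam (j + 1) - extKnot lam (j - k))⁻¹ *
          (e (j + 1) - e j)) * bpoly (extKnot lam) (m : ℕ) k ((j : ℤ) - k)).eval x := by
  have ht := isKnotSeq_extKnot hlam
  -- `e` runs over all B-splines of degree `k + 1`, and `Z_{i-k}` has slot `i + 1`. The first and
  -- last B-spline have no ZB-spline, hence the zero end values.
  rw [← derivative_sum_bpoly ht.mono (by positivity) (by exact_mod_cast Nat.lt_succ_iff.mp m.2),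
    show g + (k + 1) + 1 = g + k + 1 + 1 from by ring, Finset.sum_range_succ, hn,
    Finset.sum_range_succ', h0]
  simp only [map_zero, zero_mul, add_zero, Polynomial.derivative_sum, Polynomial.eval_finsetSum,
    Polynomial.derivative_C_mul, Polynomial.eval_mul, Polynomial.eval_C]
  rw [Finset.sum_range]
  refine Finset.sum_congr rfl fun i _ => ?_
  rw [zbVec, zbspline_eq_eval_derivative hlam hx]
  have e1 : ((i : ℕ) : ℤ) - k = (((i : ℕ) + 1 : ℕ) : ℤ) - (k + 1 : ℕ) := by push_cast; ring
  rw [e1]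

theorem IsSpline.exists_eq_zbBarVec (hlam : StrictMono lam) {k : ℕ} {f : ℝ → ℝ}
    (hf : IsSpline k lam f) :
    ∃ r : Fin (g + k) ⊕ Unit → ℝ, ∀ x ∈ Set.Icc (lam 0) (lam (Fin.last (g + 1))),
      f x = r ⬝ᵥ zbBarVec k lam x := by
  have ht := isKnotSeq_extKnot hlam
  obtain ⟨c, hc⟩ := hf.exists_eq_sum_bpoly hlam
  set Δ : ℕ → ℝ := fun j => extKnot lam (j + 1) - extKnot lam (j - k) with hΔ
  have hΔpos : ∀ j < g + k + 1, 0 < Δ j := fun j hj => sub_pos.mpr (ht.lt hj)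
  have hS : 0 < ∑ j ∈ Finset.range (g + k + 1), Δ j :=
    Finset.sum_pos (fun j hj => hΔpos j (Finset.mem_range.mp hj)) (by simp)
  -- The mean of `c` with weights `Δ` is the only constant for which the partial sums `e` of `(c j -
  -- w) Δ j / (k + 1)` return to zero at the end.
  set w : ℝ := (∑ j ∈ Finset.range (g + k + 1), c j * Δ j) /
    ∑ j ∈ Finset.range (g + k + 1), Δ j with hw
  set e : ℕ → ℝ := fun n => ∑ j ∈ Finset.range n, (c j - w) * Δ j / (k + 1) with he
  have hk : (k : ℝ) + 1 ≠ 0 := by positivity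
  have hn : e (g + k + 1) = 0 := by
    simp only [he]
    rw [← Finset.sum_div]
    simp only [sub_mul, Finset.sum_sub_distrib]
    rw [← Finset.mul_sum, hw, div_mul_cancel₀ _ hS.ne', sub_self, zero_div]
  refine ⟨Sum.elim (fun i => e (i + 1)) (fun _ => w), fun x hx => ?_⟩
  obtain ⟨m, hm⟩ := exists_mem_knotInterval hx
  have hsum := congrArg (fun p => w * Polynomial.eval x p) (sum_bpoly ht.mono
    (ht.lt_succ m (by omega)) (g := g) (by positivity) (by omega) k)
  simp only [Polynomial.eval_one, mul_one] at hsum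
  rw [zbBarVec, dotProduct, Fintype.sum_sum_type]
  simp only [Sum.elim_inl, Sum.elim_inr, Finset.univ_unique, Finset.sum_singleton, mul_one]
  rw [sum_zbVec_eq_eval hlam k hm e (by simp [he]) hn, hc m x hm, ← hsum]
  simp only [Polynomial.eval_finsetSum, Polynomial.eval_mul, Polynomial.eval_C]
  rw [Finset.mul_sum, ← Finset.sum_add_distrib]
  refine Finset.sum_congr rfl fun j hj => ?_
  have hne := (hΔpos j (Finset.mem_range.mp hj)).ne'
  rw [← add_mul]
  congr 1
  simp only [he, Finset.sum_range_succ]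
  change c j = (k + 1) * (Δ j)⁻¹ * _ + w
  field_simp
  ring

/-- In the B-spline basis a vanishing combination says that `e (j + 1) - e j` is `-w / (k + 1)`
times `Δ j`. These differences telescope to zero while `∑ Δ j > 0`, so `w = 0` and `e` is constantly
zero. -/
theorem zbBarVec_linearIndependent (hlam : StrictMono lam) {k : ℕ} (r : Fin (g + k) ⊕ Unit → ℝ)
    (hr : ∀ x ∈ Set.Icc (lam 0) (lam (Fin.last (g + 1))), r ⬝ᵥ zbBarVec k lam x = 0) : r = 0 := by
  have ht := isKnotSeq_extKnot hlam
  set w : ℝ := r (Sum.inr ()) with hw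
  set e : ℕ → ℝ := fun n => if h : 0 < n ∧ n - 1 < g + k then r (Sum.inl ⟨n - 1, h.2⟩) else 0
    with he
  have h0 : e 0 = 0 := by simp [he]
  have hn : e (g + k + 1) = 0 := by simp [he]
  have hei : ∀ i : Fin (g + k), e (i + 1) = r (Sum.inl i) := by
    intro i
    simp [he]
  set Δ : ℕ → ℝ := fun j => extKnot lam (j + 1) - extKnot lam (j - k) with hΔ
  have hΔpos : ∀ j < g + k + 1, 0 < Δ j := fun j hj => sub_pos.mpr (ht.lt hj)
  have hS : 0 < ∑ j ∈ Finset.range (g + k + 1), Δ j :=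
    Finset.sum_pos (fun j hj => hΔpos j (Finset.mem_range.mp hj)) (by simp)
  have hcoef := bpoly_linearIndependent ht k
    (fun j => ((k : ℝ) + 1) * (Δ j)⁻¹ * (e (j + 1) - e j) + w) (by
      intro m hm
      refine Polynomial.eq_of_eval_eq_on_knotInterval hlam ⟨m, by omega⟩ fun x hx => ?_
      have h1 := hr x (knotInterval_subset_Icc hlam.monotone _ hx)
      rw [zbBarVec, dotProduct, Fintype.sum_sum_type] at h1
      simp only [Sum.elim_inl, Sum.elim_inr, Finset.univ_unique, Finset.sum_singleton, mul_one,
        ← hei] at h1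
      rw [sum_zbVec_eq_eval hlam k hx e h0 hn] at h1
      have hsplit : ∀ (a b : ℝ) (p : Polynomial ℝ), Polynomial.C (a + b) * p =
          Polynomial.C a * p + Polynomial.C b * p := fun a b p => by
        rw [Polynomial.C_add, add_mul]
      simp only [hsplit, Finset.sum_add_distrib, ← Finset.mul_sum]
      rw [sum_bpoly ht.mono (ht.lt_succ m hm) (by positivity) (by omega), mul_one,
        Polynomial.eval_add, Polynomial.eval_C, Polynomial.eval_zero]
      exact h1)
  have hk : (k : ℝ) + 1 ≠ 0 := by positivity
  have hdiff : ∀ j < g + k + 1, e (j + 1) - e j = -(w / (k + 1)) * Δ j := by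
    intro j hj
    have h1 : ((k : ℝ) + 1) * (Δ j)⁻¹ * (e (j + 1) - e j) + w = 0 := hcoef j hj
    have hne := (hΔpos j hj).ne'
    field_simp at h1 ⊢
    linarith
  have htel : ∑ j ∈ Finset.range (g + k + 1), (e (j + 1) - e j) = 0 := by
    rw [Finset.sum_range_sub, hn, h0, sub_zero]
  have hw0 : w = 0 := by
    rw [Finset.sum_congr rfl fun j hj => hdiff j (Finset.mem_range.mp hj), ← Finset.mul_sum] at htel
    have := (mul_eq_zero.mp htel).resolve_right hS.ne'
    field_simp at this
    linarith
  have hzero : ∀ j < g + k + 1, e j = 0 := by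
    intro j
    induction j with
    | zero => intro _; exact h0
    | succ j ih =>
      intro hj
      have h1 := hdiff j (by omega)
      rw [hw0, ih (by omega)] at h1
      simpa using h1
  ext i
  rcases i with i | i
  · rw [← hei, hzero _ (by omega), Pi.zero_apply]
  · exact hw0

theorem zbspline_integral (hlam : StrictMono lam) (k : ℕ) (i : ℤ) (h1 : -(k : ℤ) ≤ i)
    (h2 : i < g) :
    IntervalIntegrable (zbspline lam k i) volume (lam 0) (lam (Fin.last (g + 1))) ∧
      ∫ x in (lam 0)..(lam (Fin.last (g + 1))), zbspline lam k i x = 0 := by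
  have ht := isKnotSeq_extKnot hlam
  set q : ℕ → Polynomial ℝ := fun m => bpoly (extKnot lam) m (k + 1) i with hq
  set τ : ℕ → ℝ := fun m => extKnot lam m with hτ
  have hlt : ∀ m < g + 1, τ m < τ (m + 1) := by
    intro m hm
    have := ht.lt_succ m (by omega)
    simpa [hτ] using this
  have hEq : ∀ m < g + 1, Set.EqOn (fun x => (Polynomial.derivative (q m)).eval x)
      (zbspline lam k i) (Set.Ioo (τ m) (τ (m + 1))) := by
    intro m hm x hx
    refine (zbspline_eq_eval_derivative hlam (m := ⟨m, hm⟩) ?_ k i).symm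
    refine Ioo_subset_knotInterval _ ?_
    rw [← extKnot_val_castSucc (lam := lam), ← extKnot_val_succ (lam := lam)]
    simpa [hτ] using hx
  have hint : ∀ m < g + 1, IntervalIntegrable (zbspline lam k i) volume (τ m) (τ (m + 1)) := by
    intro m hm
    refine ((Polynomial.continuous _).intervalIntegrable _ _).congr_uIoo
      (f := fun x => (Polynomial.derivative (q m)).eval x) ?_
    rw [Set.uIoo_of_le (hlt m hm).le]
    exact hEq m hm
  -- Continuity at the knots makes the sum telescope. The last piece has no successor: there `q g`
  -- vanishes at the end point, and the correction cancels the spurious `q (g + 1)`.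
  have hval : ∀ m < g + 1, ∫ x in (τ m)..(τ (m + 1)), zbspline lam k i x =
      (q (m + 1)).eval (τ (m + 1)) - (q m).eval (τ m) +
        if m = g then -(q (g + 1)).eval (τ (g + 1)) else 0 := by
    intro m hm
    rw [← intervalIntegral.integral_congr_Ioo_of_le (hlt m hm).le (hEq m hm),
      intervalIntegral.integral_eq_sub_of_hasDerivAt (fun x _ => (q m).hasDerivAt x)
        ((Polynomial.continuous _).intervalIntegrable _ _)]
    split_ifs with hmg
    · subst hmg
      have h3 : (q m).eval (τ (m + 1)) = 0 := by
        have := bpoly_eval_right (t := extKnot lam) (m := m) ht.right (k + 1) i h2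
        simpa [hq, hτ] using this
      rw [h3]
      ring
    · have h3 := ht.lt_succ (m + 1) (by omega)
      have h4 := bpoly_eval_knot (t := extKnot lam) (m := m) (ht.lt_succ m (by omega))
        (by push_cast at h3; rwa [add_assoc] at h3) k i
      have h5 : (q m).eval (τ (m + 1)) = (q (m + 1)).eval (τ (m + 1)) := by
        simpa [hq, hτ] using h4
      rw [h5, add_zero]
  have e0 : τ 0 = lam 0 := by simpa [hτ] using extKnot_zero
  have e1 : τ (g + 1) = lam (Fin.last (g + 1)) := by simpa [hτ] using extKnot_last
  rw [← e0, ← e1]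
  refine ⟨IntervalIntegrable.trans_iterate hint, ?_⟩
  rw [← intervalIntegral.sum_integral_adjacent_intervals hint,
    Finset.sum_congr rfl fun m hm => hval m (Finset.mem_range.mp hm), Finset.sum_add_distrib,
    Finset.sum_range_sub (fun m => (q m).eval (τ m))]
  have h6 : (q 0).eval (τ 0) = 0 := by
    have := bpoly_eval_left (t := extKnot lam) ht.left (k + 1) i (by push_cast; omega)
    simpa [hq, hτ] using this
  simp [h6]

end ExtKnot

/-! ### Coefficient matrices of tensor product splines -/

section Tensor

open Matrix

theorem zbBarVec_integral {g : ℕ} {lam : Fin (g + 2) → ℝ} (hlam : StrictMono lam) (k : ℕ)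
    (i : Fin (g + k) ⊕ Unit) :
    IntegrableOn (fun x => zbBarVec k lam x i) (Set.Icc (lam 0) (lam (Fin.last (g + 1)))) ∧
      ∫ x in Set.Icc (lam 0) (lam (Fin.last (g + 1))), zbBarVec k lam x i =
        Sum.elim (fun _ => 0) (fun _ => lam (Fin.last (g + 1)) - lam 0) i := by
  have hle : lam 0 ≤ lam (Fin.last (g + 1)) := hlam.monotone (Fin.zero_le _)
  rcases i with i | i
  · obtain ⟨h1, h2⟩ := zbspline_integral hlam k (((i : ℕ) : ℤ) - k) (by omega) (by omega)
    refine ⟨(intervalIntegrable_iff_integrableOn_Icc_of_le hle).mp h1, ?_⟩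
    rw [integral_Icc_eq_integral_Ioc, ← intervalIntegral.integral_of_le hle]
    exact h2
  · simp [zbBarVec, hle]

variable {g h k l : ℕ} {lam : Fin (g + 2) → ℝ} {mu : Fin (h + 2) → ℝ}

theorem exists_matrix_of_mem_tensorSplines (hlam : StrictMono lam) (hmu : StrictMono mu)
    {s : rect lam mu → ℝ} (hs : s ∈ tensorSplines k l lam mu) :
    ∃ R : Matrix (Fin (g + k) ⊕ Unit) (Fin (h + l) ⊕ Unit) ℝ, ∀ p : rect lam mu,
      s p = zbBarVec k lam p.1.1 ⬝ᵥ R *ᵥ zbBarVec l mu p.1.2 := by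
  induction hs using Submodule.span_induction with
  | mem F hF =>
    obtain ⟨φ, ψ, hφ, hψ, hF⟩ := hF
    obtain ⟨r, hr⟩ := hφ.exists_eq_zbBarVec hlam
    obtain ⟨q, hq⟩ := hψ.exists_eq_zbBarVec hmu
    refine ⟨vecMulVec r q, fun p => ?_⟩
    rw [hF, hr _ p.2.1, hq _ p.2.2, vecMulVec_mulVec, dotProduct_comm r]
    simp [mul_comm]
  | zero => exact ⟨0, fun p => by simp⟩
  | add s t _ _ hs ht =>
    obtain ⟨R, hR⟩ := hs
    obtain ⟨Q, hQ⟩ := ht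
    exact ⟨R + Q, fun p => by rw [Pi.add_apply, hR, hQ, add_mulVec, dotProduct_add]⟩
  | smul c s _ hs =>
    obtain ⟨R, hR⟩ := hs
    exact ⟨c • R, fun p => by rw [Pi.smul_apply, hR, smul_mulVec, dotProduct_smul]⟩

/-- Univariate independence is used twice: in `x` for fixed `y`, then in `y` for each row of `R`. -/
theorem matrix_eq_zero_of_zbBarVec (hlam : StrictMono lam) (hmu : StrictMono mu)
    (R : Matrix (Fin (g + k) ⊕ Unit) (Fin (h + l) ⊕ Unit) ℝ)
    (hR : ∀ p : rect lam mu, zbBarVec k lam p.1.1 ⬝ᵥ R *ᵥ zbBarVec l mu p.1.2 = 0) : R = 0 := by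
  have h1 : ∀ y ∈ Set.Icc (mu 0) (mu (Fin.last (h + 1))), R *ᵥ zbBarVec l mu y = 0 := by
    intro y hy
    refine zbBarVec_linearIndependent hlam _ fun x hx => ?_
    rw [dotProduct_comm]
    exact hR ⟨(x, y), hx, hy⟩
  funext i
  exact zbBarVec_linearIndependent hmu _ fun y hy => congrFun (h1 y hy) i

/-- By Fubini every product with a ZB-spline factor integrates to zero, and only the product of the
two constants is left. -/
theorem integral_zbBarVec_matrix (hlam : StrictMono lam) (hmu : StrictMono mu)
    (R : Matrix (Fin (g + k) ⊕ Unit) (Fin (h + l) ⊕ Unit) ℝ) :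
    ∫ p : rect lam mu, zbBarVec k lam p.1.1 ⬝ᵥ R *ᵥ zbBarVec l mu p.1.2
        ∂(Measure.comap Subtype.val volume) =
      R (Sum.inr ()) (Sum.inr ()) *
        ((lam (Fin.last (g + 1)) - lam 0) * (mu (Fin.last (h + 1)) - mu 0)) := by
  rw [integral_subtype_comap (measurableSet_Icc.prod measurableSet_Icc)
    (fun p : ℝ × ℝ => zbBarVec k lam p.1 ⬝ᵥ R *ᵥ zbBarVec l mu p.2)]
  have hint : ∀ i j, IntegrableOn
      (fun p : ℝ × ℝ => R i j * (zbBarVec k lam p.1 i * zbBarVec l mu p.2 j)) (rect lam mu) := by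
    intro i j
    have := (zbBarVec_integral hlam k i).1.mul_prod (zbBarVec_integral hmu l j).1
    rw [Measure.prod_restrict] at this
    exact this.const_mul _
  have hexp : ∀ p : ℝ × ℝ, zbBarVec k lam p.1 ⬝ᵥ R *ᵥ zbBarVec l mu p.2 =
      ∑ i, ∑ j, R i j * (zbBarVec k lam p.1 i * zbBarVec l mu p.2 j) := by
    intro p
    simp only [dotProduct, mulVec, Finset.mul_sum]
    exact Finset.sum_congr rfl fun i _ => Finset.sum_congr rfl fun j _ => by ring
  have hprod : ∀ i j, ∫ p in rect lam mu, R i j * (zbBarVec k lam p.1 i * zbBarVec l mu p.2 j) =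
      R i j * (Sum.elim (fun _ => 0) (fun _ => lam (Fin.last (g + 1)) - lam 0) i *
        Sum.elim (fun _ => 0) (fun _ => mu (Fin.last (h + 1)) - mu 0) j) := by
    intro i j
    rw [integral_const_mul, Measure.volume_eq_prod,
      setIntegral_prod_mul (fun x => zbBarVec k lam x i) (fun y => zbBarVec l mu y j),
      (zbBarVec_integral hlam k i).2, (zbBarVec_integral hmu l j).2]
  simp only [hexp]
  rw [integral_finsetSum _ fun i _ => integrable_finsetSum _ fun j _ => hint i j]
  simp only [integral_finsetSum _ fun j _ => hint _ j, hprod]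
  simp [Fintype.sum_sum_type]

theorem zbBarVec_coeffMatrix (z : Matrix (Fin (g + k)) (Fin (h + l)) ℝ) (v : Fin (g + k) → ℝ)
    (u : Fin (h + l) → ℝ) (p : rect lam mu) :
    zbBarVec k lam p.1.1 ⬝ᵥ coeffMatrix z v u *ᵥ zbBarVec l mu p.1.2 =
      zbCombination k l lam mu z v u p := by
  simp only [dotProduct, mulVec, coeffMatrix, zbBarVec, zbCombination, Fintype.sum_sum_type,
    Finset.univ_unique, Finset.sum_singleton, Sum.elim_inl, Sum.elim_inr, fromBlocks_apply₁₁,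
    fromBlocks_apply₁₂, fromBlocks_apply₂₁, fromBlocks_apply₂₂, replicateCol_apply,
    replicateRow_apply, Matrix.zero_apply, mul_one, one_mul, add_zero, mul_add, Finset.sum_add_distrib,
    Finset.mul_sum]
  rw [add_right_comm]
  congr 2
  · exact Finset.sum_congr rfl fun i _ => Finset.sum_congr rfl fun j _ => by ring
  · exact Finset.sum_congr rfl fun i _ => by ring

theorem coeffMatrix_toBlocks {m n : ℕ} (R : Matrix (Fin m ⊕ Unit) (Fin n ⊕ Unit) ℝ)
    (hR : R (Sum.inr ()) (Sum.inr ()) = 0) :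
    coeffMatrix R.toBlocks₁₁ (fun i => R (Sum.inl i) (Sum.inr ()))
      (fun j => R (Sum.inr ()) (Sum.inl j)) = R := by
  ext (i | i) (j | j)
  · rfl
  · rfl
  · rfl
  · exact hR.symm

end Tensor

theorem mainTheorem7 (k l g h : ℕ) (lam : Fin (g + 2) → ℝ) (hlam : StrictMono lam)
    (mu : Fin (h + 2) → ℝ) (hmu : StrictMono mu) (s : rect lam mu → ℝ)
    (hs : s ∈ zeroIntegralSplines k l lam mu) :
    (∃! c : Matrix (Fin (g + k)) (Fin (h + l)) ℝ × (Fin (g + k) → ℝ) × (Fin (h + l) → ℝ),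
      s = zbCombination k l lam mu c.1 c.2.1 c.2.2) ∧
    (∀ (z : Matrix (Fin (g + k)) (Fin (h + l)) ℝ) (v : Fin (g + k) → ℝ) (u : Fin (h + l) → ℝ),
      s = zbCombination k l lam mu z v u ↔
        ∀ p : rect lam mu, s p =
          zbBarVec k lam p.1.1 ⬝ᵥ Matrix.mulVec (coeffMatrix z v u) (zbBarVec l mu p.1.2)) := by

  refine ⟨?_, fun z v u => ?_⟩
  · obtain ⟨hs, hint⟩ := hs
    obtain ⟨R, hR⟩ := exists_matrix_of_mem_tensorSplines hlam hmu hs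
    have hcorner : R (Sum.inr ()) (Sum.inr ()) = 0 := by
      rw [funext hR, integral_zbBarVec_matrix hlam hmu] at hint
      refine (mul_eq_zero.mp hint).resolve_right (mul_ne_zero ?_ ?_)
      · exact (sub_pos.mpr (hlam Fin.last_pos)).ne'
      · exact (sub_pos.mpr (hmu Fin.last_pos)).ne'
    have hblocks := coeffMatrix_toBlocks R hcorner
    refine ⟨⟨R.toBlocks₁₁, fun i => R (Sum.inl i) (Sum.inr ()),
      fun j => R (Sum.inr ()) (Sum.inl j)⟩, ?_, ?_⟩
    · funext p
      rw [hR, ← zbBarVec_coeffMatrix, hblocks]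
    · rintro ⟨z, v, u⟩ hc
      -- Uniqueness holds among all matrices, hence among those with zero corner.
      have hQ : coeffMatrix z v u = R := by
        rw [← sub_eq_zero]
        refine matrix_eq_zero_of_zbBarVec hlam hmu _ fun p => ?_
        rw [Matrix.sub_mulVec, dotProduct_sub, zbBarVec_coeffMatrix, ← hR, ← congrFun hc p,
          sub_self]
      subst hQ
      rfl
  · simp only [zbBarVec_coeffMatrix]
    exact funext_iff
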